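/- Finite binary strings are the elements $s$ of $\{0,1\}^*$, with length $|s|$. A prefix-free machine is a partial recursive function $C\colon\{0,1\}^*\to\{0,1\}^*$ such that no string in its domain is a proper prefix of another string in its domain; let $H_C(s)=\min\{|p| : C(p)=s\}$ (which is $\infty$ if there is no such $p$). A prefix-free machine $V$ is optimal if for every prefix-free machine $C$ there is $d\in\mathbb{N}$ such that for every $p$ in the domain of $C$ there is $q$ in the domain of $V$ with $V(q)=C(p)$ and $|q|\le|p|+d$. Fix an optimal prefix-free machine $U$ and write $H=H_U$. For an optimal prefix-free machine $V$ and $0<T\le1$ let $$CS_V(T)=\sum_{s\in\{0,1\}^*,\ H_V(s)<|s|}2^{-|s|/T},$$ a convergent series. A real $\alpha$ is right-computable if there is a total recursive sequence $(f(n))$ of rationals with $\alpha\le f(n)$ for all $n$ and $\lim_{n\to\infty}f(n)=\alpha$; it is left-computable if $-\alpha$ is right-computable. Let $\alpha{\restriction}n$ be the first $n$ bits of the base-two expansion of $\alpha-\lfloor\alpha\rfloor$ with infinitely many zeros. A real $\alpha$ is $T$-compressible if $\limsup_{n\to\infty}H(\alpha{\restriction}n)/n\le T$, i.e. $H(\alpha{\restriction}n)\le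 Tn+o(n)$. Theorem. Let $V$ be any optimal prefix-free machine. For every real $T\in(0,1)$, if $CS_V(T)$ is left-computable and $T$ is right-computable, then $T$ is $T$-compressible; moreover $H(T{\restriction}n)\le Tn+O(\log n)$, i.e. there is a constant $C$ such that $H(T{\restriction}n)\le Tn+C\log_2 n$ for all $n\ge2$. -/

import Mathlib

open Filter Topology
open scoped ENNReal

namespace AIT

/-- A prefix-free machine: a partial recursive function on finite binary strings whose domain
contains no two distinct strings one of which is a prefix of the other. -/
def IsPrefixFreeMachine (C : List Bool →. List Bool) : Prop :=
  Partrec C ∧ ∀ p ∈ C.Dom, ∀ q ∈ C.Dom, p <+: q → p = q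

/-- An optimal prefix-free machine: it simulates every prefix-free machine at the cost of at most
a constant number of additional input bits. -/
def IsOptimal (V : List Bool →. List Bool) : Prop :=
  IsPrefixFreeMachine V ∧
    ∀ C : List Bool →. List Bool, IsPrefixFreeMachine C →
      ∃ d : ℕ, ∀ p s : List Bool, s ∈ C p → ∃ q : List Bool, s ∈ V q ∧ q.length ≤ p.length + d

/-- `H C s` is the least length of an input on which `C` outputs `s` (`⊤` if there is none). -/
noncomputable def H (C : List Bool →. List Bool) (s : List Bool) : ℕ∞ :=
  ⨅ p ∈ {p : List Bool | s ∈ C p}, (p.length : ℕ∞)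

/-- `CS V T` is the sum of `2 ^ (-|s| / T)` over all strings `s` that `V` compresses, that is, with
`H V s < |s|`. For optimal `V` and `0 < T ≤ 1` the series converges, by Kraft's inequality. -/
noncomputable def CS (V : List Bool →. List Bool) (T : ℝ) : ℝ :=
  ∑' s : {s : List Bool // H V s < (s.length : ℕ∞)}, (2 : ℝ) ^ (-(s.1.length : ℝ) / T)

/-- The first `n` bits of the base-two expansion of the fractional part of `α`, where the
expansion with infinitely many zeros is taken. -/
noncomputable def firstBits (α : ℝ) (n : ℕ) : List Bool :=
  List.ofFn fun i : Fin n => decide (Real.digits (Int.fract α) 2 i = 1)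

/-- A total recursive sequence of rationals: `f n = (a n - b n) / (c n + 1)` for total recursive
functions `a`, `b`, `c` on the natural numbers. -/
def IsRecursiveRatSeq (f : ℕ → ℚ) : Prop :=
  ∃ a b c : ℕ → ℕ, Computable a ∧ Computable b ∧ Computable c ∧
    ∀ n, f n = ((a n : ℚ) - (b n : ℚ)) / ((c n : ℚ) + 1)

/-- `α` is the limit of a recursive sequence of rational upper bounds. -/
def RightComputable (α : ℝ) : Prop :=
  ∃ f : ℕ → ℚ, IsRecursiveRatSeq f ∧ (∀ n, α ≤ (f n : ℝ)) ∧
    Tendsto (fun n => (f n : ℝ)) atTop (𝓝 α)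

def LeftComputable (α : ℝ) : Prop :=
  RightComputable (-α)

/-- `α` is `T`-compressible (`T > 0`) with respect to the complexity `H U`:
`limsup H(first n bits of α) / n ≤ T`. -/
def Compressible (U : List Bool →. List Bool) (T α : ℝ) : Prop :=
  limsup (fun n : ℕ => ((H U (firstBits α n) : ℕ∞) : ℝ≥0∞) / (n : ℝ≥0∞)) atTop ≤ ENNReal.ofReal T

end AIT

/-! Let `Ω` be the sum of `2 ^ (-|s|)` over the strings `s` compressed by `V`; by Kraft's inequality
`Ω ≤ 1`. Since `2 ^ (-|s| / T) = (2 ^ (-|s|)) ^ (1 / T)` with `1 / T ≥ 1`, an enumeration stage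
missing less than `2 ^ (-m)` of `Ω` misses at most `2 ^ (-m / T)` of `CS V T`. So about `T * n` bits
of `Ω` suffice to find a stage `k` whose finite sum is within `2 ^ (-n)` of `CS V T`
(`CS_sub_stageSum_le`).

Given `k`, search for an upper bound `t j` of `T` at which the finite sum exceeds a lower bound of
`CS V T` by at most a few `2 ^ (-n)`. Such a `j` exists by convergence. Any such `t j` is within
`O(2 ^ (-n))` of `T`, because the finite sum grows in `t` with slope bounded below by the term of
one fixed compressed string (`stageSum_sub_ge`). Hence `⌊2 ^ n * t j⌋` differs from `⌊2 ^ n * T⌋` by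
a bounded number, which is supplied as advice (`exists_partrec_firstBits`). Encoding `m`, `n` and
the advice in a self-delimiting header costs `O(log n)` bits (`IsOptimal.exists_H_le`). -/

namespace AIT

/-! ### Self-delimiting inputs and upper bounds for `H` -/

/-- The value of a string read as a binary numeral, most significant bit first. -/
def bitsVal (w : List Bool) : ℕ := w.foldl (fun acc b => 2 * acc + b.toNat) 0

lemma exists_bitsVal_eq (m : ℕ) : ∀ W < 2 ^ m, ∃ w : List Bool, w.length = m ∧ bitsVal w = W := by
  induction m with
  | zero => intro W hW; exact ⟨[], rfl, by simp [bitsVal]; omega⟩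
  | succ m ih =>
    intro W hW
    obtain ⟨w, hw, hv⟩ := ih (W / 2) (by rw [pow_succ] at hW; omega)
    refine ⟨w ++ [decide (W % 2 = 1)], by simp [hw], ?_⟩
    unfold bitsVal at hv ⊢
    rw [List.foldl_append, hv]
    rcases Nat.mod_two_eq_zero_or_one W with h | h <;> simp [h] <;> omega

lemma primrec_bitsVal : Primrec bitsVal :=
  Primrec.list_foldl Primrec.id (Primrec.const 0)
    (Primrec.nat_add.comp (Primrec.nat_mul.comp (Primrec.const 2) (Primrec.fst.comp Primrec.snd))
      ((Primrec.dom_bool Bool.toNat).comp (Primrec.snd.comp Primrec.snd))).to₂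

/-- The length of the initial run of ones. -/
def runLength (p : List Bool) : ℕ := (p.takeWhile id).length

/-- The number in the header of `p`: a run of `l` ones is followed by a zero and the `l` bits of the
number. -/
def header (p : List Bool) : ℕ := bitsVal ((p.drop (runLength p + 1)).take (runLength p))

/-- What follows the header. -/
def payload (p : List Bool) : List Bool := p.drop (2 * runLength p + 1)

/-- The first component of the header is the length of the payload. -/
def WellFormed (p : List Bool) : Prop :=
  p.length = 2 * runLength p + 1 + (header p).unpair.1

instance : DecidablePred WellFormed := fun _ => inferInstanceAs (Decidable (_ = _))

lemma primrec_runLength : Primrec runLength :=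
  Primrec.list_length.comp (Primrec.list_takeWhile Primrec.id)

lemma primrec_header : Primrec header :=
  primrec_bitsVal.comp (Primrec.list_take.comp primrec_runLength
    (Primrec.list_drop.comp (Primrec.succ.comp primrec_runLength) Primrec.id))

lemma primrec_payload : Primrec payload :=
  Primrec.list_drop.comp (Primrec.succ.comp (Primrec.nat_double.comp primrec_runLength)) Primrec.id

lemma primrecPred_wellFormed : PrimrecPred WellFormed :=
  Primrec.eq.comp Primrec.list_length
    (Primrec.nat_add.comp (Primrec.succ.comp (Primrec.nat_double.comp primrec_runLength))
      (Primrec.fst.comp (Primrec.unpair.comp primrec_header)))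

lemma runLength_append {p : List Bool} (hp : runLength p < p.length) (r : List Bool) :
    runLength (p ++ r) = runLength p := by
  unfold runLength at *
  rw [List.takeWhile_append, if_neg hp.ne]

/-- The run of ones and the header can be read from `p` alone, and they determine the total length;
an extension of `p` has the same header, so it cannot be longer. -/
lemma WellFormed.eq_of_prefix {p q : List Bool} (hp : WellFormed p) (hq : WellFormed q)
    (h : p <+: q) : p = q := by
  obtain ⟨r, rfl⟩ := h
  unfold WellFormed at hp hq
  have h1 := runLength_append (p := p) (by omega) r
  have h2 : header (p ++ r) = header p := by
    unfold header
    rw [h1, List.drop_append_of_le_length (by omega), List.take_append_of_le_length]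
    rw [List.length_drop]; omega
  rw [h1, h2, List.length_append] at hq
  have : r = [] := List.eq_nil_of_length_eq_zero (by omega)
  simp [this]

/-- The prefix-free machine that runs `f` on the header and the payload. -/
def headerMachine (f : ℕ × List Bool →. List Bool) (p : List Bool) : Part (List Bool) :=
  bif decide (WellFormed p) then f (header p, payload p) else Part.none

lemma isPrefixFreeMachine_headerMachine {f : ℕ × List Bool →. List Bool} (hf : Partrec f) :
    IsPrefixFreeMachine (headerMachine f) := by
  refine ⟨Partrec.cond primrecPred_wellFormed.decide.to_comp
    (hf.comp (primrec_header.pair primrec_payload).to_comp) Partrec.none, ?_⟩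
  have key : ∀ p ∈ PFun.Dom (headerMachine f), WellFormed p := by
    intro p hp
    by_contra h
    obtain ⟨y, hy⟩ := (PFun.mem_dom _ _).1 hp
    simp [headerMachine, h] at hy
  exact fun p hp q hq h => (key p hp).eq_of_prefix (key q hq) h

/-- A string computed by `f` from a number `a < 2 ^ l` and a string whose length is the first
component of `a` has an input of length `2 * l + |w| + O(1)`. -/
theorem IsOptimal.exists_H_le {U : List Bool →. List Bool} (hU : IsOptimal U)
    {f : ℕ × List Bool →. List Bool} (hf : Partrec f) :
    ∃ d : ℕ, ∀ (l a : ℕ) (w s : List Bool), a < 2 ^ l → w.length = a.unpair.1 → s ∈ f (a, w) →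
      H U s ≤ ((2 * l + w.length + d : ℕ) : ℕ∞) := by
  obtain ⟨d, hd⟩ := hU.2 _ (isPrefixFreeMachine_headerMachine hf)
  refine ⟨d + 1, fun l a w s ha hw hs => ?_⟩
  obtain ⟨u, hu, hua⟩ := exists_bitsVal_eq l a ha
  set p : List Bool := List.replicate l true ++ false :: (u ++ w) with hp
  have hrun : runLength p = l := by
    unfold runLength
    rw [hp, List.takeWhile_append]
    simp
  have hhead : header p = a := by
    unfold header
    rw [hrun, hp, List.drop_append]
    simp [hua, ← hu]
  have hpay : payload p = w := by
    unfold payload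
    rw [hrun, hp, List.drop_append]
    simp [hu, show 2 * l + 1 - l = l + 1 by omega]
    omega
  have hlen : p.length = 2 * l + 1 + w.length := by simp [hp, hu]; omega
  have hwf : WellFormed p := by
    unfold WellFormed
    rw [hrun, hhead, hlen, hw]
  obtain ⟨q, hq, hql⟩ := hd p s (by simpa [headerMachine, hwf, hhead, hpay] using hs)
  refine (iInf₂_le q hq).trans ?_
  exact_mod_cast (by omega : q.length ≤ 2 * l + w.length + (d + 1))

/-! ### Kraft's inequality for prefix-free sets -/

/-- The first words of two factorizations of one string are prefixes of that string, so one is a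
prefix of the other; they are therefore equal and can be cancelled. -/
lemma uniquelyDecodable_of_prefixFree {S : Set (List Bool)} (hS : ∀ p ∈ S, ∀ q ∈ S, p <+: q → p = q)
    (hnil : [] ∉ S) : InformationTheory.UniquelyDecodable S := by
  intro L₁
  induction L₁ with
  | nil =>
    intro L₂ _ h₂ h
    cases L₂ with
    | nil => rfl
    | cons v L =>
      have : v = [] := by
        have := h.symm
        simp at this
        exact this.1
      exact absurd (this ▸ h₂ v (by simp)) hnil
  | cons w L₁ ih =>
    intro L₂ h₁ h₂ h
    cases L₂ with
    | nil =>
      have : w = [] := by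
        simp at h
        exact h.1
      exact absurd (this ▸ h₁ w (by simp)) hnil
    | cons v L₂ =>
      rw [List.flatten_cons, List.flatten_cons] at h
      have hwv : w = v := by
        rcases List.prefix_or_prefix_of_prefix (List.prefix_append w L₁.flatten)
          (h ▸ List.prefix_append v L₂.flatten) with h' | h'
        · exact hS _ (h₁ w (by simp)) _ (h₂ v (by simp)) h'
        · exact (hS _ (h₂ v (by simp)) _ (h₁ w (by simp)) h').symm
      subst hwv
      rw [ih L₂ (fun x hx => h₁ x (by simp [hx])) (fun x hx => h₂ x (by simp [hx]))
        (List.append_cancel_left h)]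

/-- Kraft's inequality for finite prefix-free sets. -/
theorem kraft_of_prefixFree (S : Finset (List Bool))
    (hS : ∀ p ∈ S, ∀ q ∈ S, p <+: q → p = q) : ∑ p ∈ S, (1 / 2 : ℝ) ^ p.length ≤ 1 := by
  by_cases hnil : [] ∈ S
  · have : S = {[]} := by
      ext q
      simp only [Finset.mem_singleton]
      exact ⟨fun hq => (hS _ hnil q hq (List.nil_prefix)).symm, fun hq => hq ▸ hnil⟩
    simp [this]
  · have := InformationTheory.kraft_mcmillan_inequality (S := S)
      (uniquelyDecodable_of_prefixFree (S := (S : Set (List Bool))) (by simpa using hS)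
        (by simpa using hnil))
    simpa using this

/-! ### Enumeration and weight of the compressed strings -/

/-- The length of the string with code `i`. -/
def codeLength (i : ℕ) : ℕ := ((Encodable.decode i : Option (List Bool)).getD []).length

@[simp] lemma codeLength_encode (s : List Bool) : codeLength (Encodable.encode s) = s.length := by
  simp [codeLength]

lemma primrec_codeLength : Primrec codeLength :=
  Primrec.list_length.comp (Primrec.option_getD.comp Primrec.decode (Primrec.const []))

lemma H_lt_iff {V : List Bool →. List Bool} {s : List Bool} {n : ℕ} :
    H V s < (n : ℕ∞) ↔ ∃ p, s ∈ V p ∧ p.length < n := by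
  simp [H, iInf_lt_iff]

/-- The strings compressed by a partial recursive function can be enumerated in stages. -/
theorem exists_stages {V : List Bool →. List Bool} (hV : Partrec V) :
    ∃ B : ℕ → ℕ → Bool, Primrec₂ B ∧
      (∀ k i, B k i = true → ∃ s : List Bool, Encodable.encode s = i ∧ H V s < (s.length : ℕ∞)) ∧
      ∀ s : List Bool, H V s < (s.length : ℕ∞) → ∀ᶠ k in atTop, B k (Encodable.encode s) = true := by
  obtain ⟨c, hc⟩ := Nat.Partrec.Code.exists_code.1 hV
  -- Here `n` codes an input and `y` pairs a step bound with the code of an output. The default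
  -- length of an invalid code is harmless, since `c` has no value there.
  let R : ℕ → ℕ × ℕ → Prop := fun n y =>
    Nat.Partrec.Code.evaln y.1 c n = some y.2 ∧ codeLength n < codeLength y.2
  have hR : PrimrecRel R := by
    have h1 : Primrec fun z : ℕ × ℕ × ℕ => Nat.Partrec.Code.evaln z.2.1 c z.1 :=
      Nat.Partrec.Code.primrec_evaln.comp
        (((Primrec.fst.comp Primrec.snd).pair (Primrec.const c)).pair Primrec.fst)
    have h2 : Primrec fun z : ℕ × ℕ × ℕ => some z.2.2 :=
      Primrec.option_some.comp (Primrec.snd.comp Primrec.snd)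
    exact (Primrec.eq.comp h1 h2).and (Primrec.nat_lt.comp (primrec_codeLength.comp Primrec.fst)
      (primrec_codeLength.comp (Primrec.snd.comp Primrec.snd)))
  refine ⟨fun k i => decide (∃ n < k, R n (k, i)), ?_, fun k i h => ?_, fun s hs => ?_⟩
  · have h2 : PrimrecRel fun k i : ℕ => ∃ n < k, R n (k, i) :=
      ((PrimrecRel.exists_mem_list hR).comp (Primrec.list_range.comp Primrec.fst)
        (Primrec.fst.pair Primrec.snd)).of_eq fun _ => by simp
    exact h2.decide
  · obtain ⟨n, -, hn, hl⟩ := of_decide_eq_true h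
    have he : i ∈ c.eval n := Nat.Partrec.Code.evaln_sound hn
    rw [hc] at he
    simp only [Part.mem_bind_iff, Part.mem_ofOption, Part.mem_map_iff] at he
    obtain ⟨p, hp, s, hs, rfl⟩ := he
    refine ⟨s, rfl, H_lt_iff.2 ⟨p, hs, ?_⟩⟩
    rw [codeLength_encode] at hl
    have hp' : Encodable.decode n = some p := hp
    simpa [codeLength, hp'] using hl
  · obtain ⟨p, hp, hl⟩ := H_lt_iff.1 hs
    have he : Encodable.encode s ∈ c.eval (Encodable.encode p) := by
      rw [hc]
      simp only [Part.mem_bind_iff, Part.mem_ofOption, Part.mem_map_iff]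
      exact ⟨p, Encodable.encodek p, s, hp, rfl⟩
    obtain ⟨k, hk⟩ := Nat.Partrec.Code.evaln_complete.1 he
    filter_upwards [eventually_ge_atTop k] with k' hk'
    have := Nat.Partrec.Code.evaln_mono hk' hk
    exact decide_eq_true
      ⟨Encodable.encode p, Nat.Partrec.Code.evaln_bound this, this, by simpa using hl⟩

/-- Kraft's inequality for the strings compressed by a prefix-free machine. -/
theorem sum_two_pow_neg_length_le {V : List Bool →. List Bool} (hV : IsPrefixFreeMachine V)
    (F : Finset (List Bool)) (hF : ∀ s ∈ F, H V s < (s.length : ℕ∞)) :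
    ∑ s ∈ F, (1 / 2 : ℝ) ^ s.length ≤ 1 := by
  classical
  have h (s : List Bool) : ∃ p, s ∈ F → s ∈ V p ∧ p.length < s.length := by
    by_cases hs : s ∈ F
    · obtain ⟨p, hp⟩ := H_lt_iff.1 (hF s hs)
      exact ⟨p, fun _ => hp⟩
    · exact ⟨[], fun h => absurd h hs⟩
  choose p hp using h
  have hinj : Set.InjOn p F := fun s hs t ht hst =>
    Part.mem_unique (hp s hs).1 (hst ▸ (hp t ht).1)
  calc ∑ s ∈ F, (1 / 2 : ℝ) ^ s.length
      ≤ ∑ s ∈ F, (1 / 2 : ℝ) ^ (p s).length := by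
        refine Finset.sum_le_sum fun s hs => ?_
        exact pow_le_pow_of_le_one (by norm_num) (by norm_num) (hp s hs).2.le
    _ = ∑ q ∈ F.image p, (1 / 2 : ℝ) ^ q.length :=
        (Finset.sum_image (f := fun q : List Bool => (1 / 2 : ℝ) ^ q.length) hinj).symm
    _ ≤ 1 := by
        refine kraft_of_prefixFree _ fun q hq r hr hqr => ?_
        obtain ⟨s, hs, rfl⟩ := Finset.mem_image.1 hq
        obtain ⟨t, ht, rfl⟩ := Finset.mem_image.1 hr
        exact hV.2 _ ((PFun.mem_dom _ _).2 ⟨s, (hp s hs).1⟩) _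
          ((PFun.mem_dom _ _).2 ⟨t, (hp t ht).1⟩) hqr

/-- An optimal machine compresses some string. -/
theorem IsOptimal.exists_compressed {V : List Bool →. List Bool} (hV : IsOptimal V) :
    ∃ s : List Bool, H V s < (s.length : ℕ∞) := by
  -- A string of `N` zeros is described by `N` alone, hence by `O(log N)` bits.
  let f : ℕ × List Bool → List Bool := fun x =>
    (List.range x.1.unpair.2).map fun _ => false
  have hf : Computable f :=
    (Primrec.list_map (Primrec.list_range.comp (Primrec.snd.comp (Primrec.unpair.comp Primrec.fst)))
      (Primrec.const false).to₂).to_comp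
  obtain ⟨d, hd⟩ := hV.exists_H_le hf.partrec
  -- The square bounds the pairing code of `0` and `2 * l + d + 1`, so that code fits in an `l`-bit
  -- header.
  obtain ⟨l, hl⟩ : ∃ l : ℕ, (2 * l + d + 2) ^ 2 < 2 ^ l := by
    have h1 : Tendsto (fun l : ℕ => ((l : ℝ) ^ 2 * (2⁻¹ : ℝ) ^ l)) atTop (𝓝 0) :=
      tendsto_pow_const_mul_const_pow_of_lt_one 2 (by norm_num) (by norm_num)
    have h2 := h1.eventually (gt_mem_nhds (show (0 : ℝ) < ((d + 5 : ℝ) ^ 2)⁻¹ by positivity))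
    obtain ⟨l, hl, hl1⟩ := (h2.and (eventually_ge_atTop 1)).exists
    refine ⟨l, ?_⟩
    have hl1' : (1 : ℝ) ≤ l := by exact_mod_cast hl1
    rw [inv_pow, ← div_eq_mul_inv, lt_inv_comm₀ (by positivity) (by positivity), inv_div,
      lt_div_iff₀ (by positivity)] at hl
    have h3 : ((2 * l + d + 2 : ℕ) : ℝ) ^ 2 < 2 ^ l := by
      refine lt_of_le_of_lt ?_ hl
      rw [← mul_pow]
      refine pow_le_pow_left₀ (by positivity) ?_ 2
      push_cast
      nlinarith [(Nat.cast_nonneg d : (0 : ℝ) ≤ d)]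
    exact_mod_cast h3
  -- The length is one more than the bound `2 * l + d` on the complexity; the component `0`
  -- announces an empty payload.
  refine ⟨f (Nat.pair 0 (2 * l + d + 1), []), ?_⟩
  have hlt : Nat.pair 0 (2 * l + d + 1) < 2 ^ l := by
    refine lt_of_lt_of_le (Nat.pair_lt_max_add_one_sq _ _) ?_
    simpa [add_assoc] using hl.le
  refine (hd l _ [] _ hlt (by simp) (Part.mem_some _)).trans_lt ?_
  simp only [f, Nat.unpair_pair, List.length_map, List.length_range, List.length_nil]
  exact_mod_cast (by omega)

/-! ### Decidable tests in integer arithmetic -/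

lemma primrec_sum_range {α : Type*} [Primcodable α] {f : α → ℕ} {g : α → ℕ → ℕ} (hf : Primrec f)
    (hg : Primrec₂ g) : Primrec fun a => ∑ i ∈ Finset.range (f a), g a i := by
  refine (Primrec.nat_rec' (h := fun a x => x.2 + g a x.1) hf (Primrec.const 0)
    (Primrec.nat_add.comp (Primrec.snd.comp Primrec.snd)
      (hg.comp Primrec.fst (Primrec.fst.comp Primrec.snd))).to₂).of_eq fun a => ?_
  induction f a with
  | zero => rfl
  | succ n ih => rw [Finset.sum_range_succ, ← ih]

lemma primrec_pow : Primrec₂ ((· ^ ·) : ℕ → ℕ → ℕ) :=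
  Primrec₂.unpaired'.1 Nat.Primrec.pow

/-- `2 ^ k` times the sum of `2 ^ (-length)` over the strings found by stage `k`. -/
def kraftSum (B : ℕ → ℕ → Bool) (k : ℕ) : ℕ :=
  ∑ i ∈ Finset.range k, bif B k i then 2 ^ (k - codeLength i) else 0

/-- The integer part of `2 ^ N * 2 ^ (-l / (a / b))`. -/
def rootFloor (N l a b : ℕ) : ℕ :=
  Nat.findGreatest (fun x => x ^ a * 2 ^ (l * b) ≤ 2 ^ (N * a)) (2 ^ N)

/-- An approximation of `2 ^ N` times the sum of `2 ^ (-length / (a / b))` over the strings found by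
stage `k`. -/
def powSum (B : ℕ → ℕ → Bool) (k N a b : ℕ) : ℕ :=
  ∑ i ∈ Finset.range k, bif B k i then rootFloor N (codeLength i) a b else 0

/-- At stage `k`, the sum of `2 ^ (-length)` exceeds `W / 2 ^ m`. -/
def KraftExceeds (B : ℕ → ℕ → Bool) (m W k : ℕ) : Prop := W * 2 ^ k < 2 ^ m * kraftSum B k

/-- `a / b ≤ 1`, and at stage `k` the approximate sum of `2 ^ (-length / (a / b))` is at most
`(v - u) / w + 2 / 2 ^ n`. -/
def PowSumLe (B : ℕ → ℕ → Bool) (n k a b u v w : ℕ) : Prop :=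
  a ≤ b ∧ powSum B k (n + k) a b * w + u * 2 ^ (n + k) ≤ v * 2 ^ (n + k) + 2 ^ (k + 1) * w

instance (B : ℕ → ℕ → Bool) (m W k : ℕ) : Decidable (KraftExceeds B m W k) :=
  inferInstanceAs (Decidable (_ < _))

instance (B : ℕ → ℕ → Bool) (n k a b u v w : ℕ) : Decidable (PowSumLe B n k a b u v w) :=
  inferInstanceAs (Decidable (_ ∧ _))

/-- The last `n` binary digits of `X`, most significant bit first. -/
def lastBits (n X : ℕ) : List Bool :=
  (List.range n).map fun i => decide (X / 2 ^ (n - 1 - i) % 2 = 1)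

section Primrec

variable {α : Type*} [Primcodable α]

lemma primrec_kraftSum {B : ℕ → ℕ → Bool} (hB : Primrec₂ B) : Primrec (kraftSum B) :=
  primrec_sum_range Primrec.id
    (Primrec.cond hB (primrec_pow.comp (Primrec.const 2)
      (Primrec.nat_sub.comp Primrec.fst (primrec_codeLength.comp Primrec.snd)))
      (Primrec.const 0)).to₂

lemma primrec_rootFloor {N l a b : α → ℕ} (hN : Primrec N) (hl : Primrec l) (ha : Primrec a)
    (hb : Primrec b) : Primrec fun x => rootFloor (N x) (l x) (a x) (b x) := by
  refine Primrec.nat_findGreatest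
    (p := fun x y => y ^ a x * 2 ^ (l x * b x) ≤ 2 ^ (N x * a x))
    (primrec_pow.comp (Primrec.const 2) hN) ?_
  exact Primrec.nat_le.comp
    (Primrec.nat_mul.comp (primrec_pow.comp Primrec.snd (ha.comp Primrec.fst))
      (primrec_pow.comp (Primrec.const 2)
        ((Primrec.nat_mul.comp hl hb).comp Primrec.fst)))
    (primrec_pow.comp (Primrec.const 2) ((Primrec.nat_mul.comp hN ha).comp Primrec.fst))

lemma primrec_powSum {B : ℕ → ℕ → Bool} (hB : Primrec₂ B) {k N a b : α → ℕ} (hk : Primrec k)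
    (hN : Primrec N) (ha : Primrec a) (hb : Primrec b) :
    Primrec fun x => powSum B (k x) (N x) (a x) (b x) :=
  primrec_sum_range hk (Primrec.cond (hB.comp (hk.comp Primrec.fst) Primrec.snd)
    (primrec_rootFloor (hN.comp Primrec.fst) (primrec_codeLength.comp Primrec.snd)
      (ha.comp Primrec.fst) (hb.comp Primrec.fst)) (Primrec.const 0)).to₂

lemma primrecPred_kraftExceeds {B : ℕ → ℕ → Bool} (hB : Primrec₂ B) {m W k : α → ℕ}
    (hm : Primrec m) (hW : Primrec W) (hk : Primrec k) :
    PrimrecPred fun x => KraftExceeds B (m x) (W x) (k x) :=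
  Primrec.nat_lt.comp (Primrec.nat_mul.comp hW (primrec_pow.comp (Primrec.const 2) hk))
    (Primrec.nat_mul.comp (primrec_pow.comp (Primrec.const 2) hm) ((primrec_kraftSum hB).comp hk))

lemma primrecPred_powSumLe {B : ℕ → ℕ → Bool} (hB : Primrec₂ B) {n k a b u v w : α → ℕ}
    (hn : Primrec n) (hk : Primrec k) (ha : Primrec a) (hb : Primrec b) (hu : Primrec u)
    (hv : Primrec v) (hw : Primrec w) :
    PrimrecPred fun x => PowSumLe B (n x) (k x) (a x) (b x) (u x) (v x) (w x) := by
  have hnk := Primrec.nat_add.comp hn hk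
  have hp := primrec_pow.comp (Primrec.const 2) hnk
  exact (Primrec.nat_le.comp ha hb).and (Primrec.nat_le.comp
    (Primrec.nat_add.comp (Primrec.nat_mul.comp (primrec_powSum hB hk hnk ha hb) hw)
      (Primrec.nat_mul.comp hu hp))
    (Primrec.nat_add.comp (Primrec.nat_mul.comp hv hp)
      (Primrec.nat_mul.comp (primrec_pow.comp (Primrec.const 2) (Primrec.succ.comp hk)) hw)))

lemma computable_decide_powSumLe {B : ℕ → ℕ → Bool} (hB : Primrec₂ B) :
    Computable fun z : ℕ × ℕ × ℕ × ℕ × ℕ × ℕ × ℕ =>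
      decide (PowSumLe B z.1 z.2.1 z.2.2.1 z.2.2.2.1 z.2.2.2.2.1 z.2.2.2.2.2.1 z.2.2.2.2.2.2) := by
  have h2 : Primrec fun z : ℕ × ℕ × ℕ × ℕ × ℕ × ℕ × ℕ => z.2.2 := Primrec.snd.comp Primrec.snd
  have h4 : Primrec fun z : ℕ × ℕ × ℕ × ℕ × ℕ × ℕ × ℕ => z.2.2.2.2 :=
    (Primrec.snd.comp Primrec.snd).comp h2
  exact (primrecPred_powSumLe hB Primrec.fst (Primrec.fst.comp Primrec.snd) (Primrec.fst.comp h2)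
    (Primrec.fst.comp (Primrec.snd.comp h2)) (Primrec.fst.comp h4)
    (Primrec.fst.comp (Primrec.snd.comp h4))
    (Primrec.snd.comp (Primrec.snd.comp h4))).decide.to_comp

lemma primrec_lastBits : Primrec₂ lastBits :=
  Primrec.list_map (Primrec.list_range.comp Primrec.fst)
    (PrimrecPred.decide (Primrec.eq.comp (Primrec.nat_mod.comp
      (Primrec.nat_div.comp (Primrec.snd.comp Primrec.fst)
        (primrec_pow.comp (Primrec.const 2) (Primrec.nat_sub.comp
          (Primrec.nat_sub.comp (Primrec.fst.comp Primrec.fst) (Primrec.const 1)) Primrec.snd)))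
      (Primrec.const 2)) (Primrec.const 1))).to₂

end Primrec

/-! ### The search procedure -/

/-- A partial recursive function that, from `m`, `n`, `e` and the binary digits of `W`, searches a
stage `k` and then an index `j`, and outputs the binary digits of `⌊2 ^ n * a j / b j⌋ - e`. -/
theorem exists_partrec_search {B : ℕ → ℕ → Bool} (hB : Primrec₂ B) {a b u v w : ℕ → ℕ}
    (ha : Computable a) (hb : Computable b) (hu : Computable u) (hv : Computable v)
    (hw : Computable w) :
    ∃ f : ℕ × List Bool →. List Bool, Partrec f ∧ ∀ (m n : ℕ) (x : List Bool),
      (∃ k, KraftExceeds B m (bitsVal x) k) →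
      (∀ k, ∃ j, PowSumLe B n k (a j) (b j) (u j) (v j) (w j)) →
      ∃ k j, KraftExceeds B m (bitsVal x) k ∧ PowSumLe B n k (a j) (b j) (u j) (v j) (w j) ∧
        ∀ e, lastBits n (2 ^ n * a j / b j - e) ∈ f (Nat.pair m (Nat.pair n e), x) := by
  let mm : ℕ × List Bool → ℕ := fun y => y.1.unpair.1
  let nn : ℕ × List Bool → ℕ := fun y => y.1.unpair.2.unpair.1
  let ee : ℕ × List Bool → ℕ := fun y => y.1.unpair.2.unpair.2
  have hmm : Primrec mm := Primrec.fst.comp (Primrec.unpair.comp Primrec.fst)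
  have hne : Primrec fun y : ℕ × List Bool => y.1.unpair.2.unpair :=
    Primrec.unpair.comp (Primrec.snd.comp (Primrec.unpair.comp Primrec.fst))
  have hnn : Primrec nn := Primrec.fst.comp hne
  have hee : Primrec ee := Primrec.snd.comp hne
  let p : ℕ × List Bool → ℕ → Bool := fun y k => decide (KraftExceeds B (mm y) (bitsVal y.2) k)
  let q : (ℕ × List Bool) × ℕ → ℕ → Bool := fun y j =>
    decide (PowSumLe B (nn y.1) y.2 (a j) (b j) (u j) (v j) (w j))
  let out : (ℕ × List Bool) × ℕ → ℕ → List Bool := fun y j =>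
    lastBits (nn y.1) (2 ^ nn y.1 * a j / b j - ee y.1)
  have hp : Computable₂ p := (primrecPred_kraftExceeds hB (hmm.comp Primrec.fst)
    (primrec_bitsVal.comp (Primrec.snd.comp Primrec.fst)) Primrec.snd).decide.to_comp
  have hq : Computable₂ q := by
    have hz : Computable fun z : ((ℕ × List Bool) × ℕ) × ℕ =>
        (nn z.1.1, z.1.2, a z.2, b z.2, u z.2, v z.2, w z.2) :=
      (hnn.to_comp.comp (Computable.fst.comp Computable.fst)).pair
      ((Computable.snd.comp Computable.fst).pair ((ha.comp Computable.snd).pair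
        ((hb.comp Computable.snd).pair ((hu.comp Computable.snd).pair
          ((hv.comp Computable.snd).pair (hw.comp Computable.snd))))))
    have h := (computable_decide_powSumLe hB).comp hz
    exact Computable₂.mk (h.of_eq fun _ => rfl)
  have hout : Computable₂ out := by
    have h : Primrec fun z : ℕ × ℕ × ℕ × ℕ => lastBits z.1 (2 ^ z.1 * z.2.1 / z.2.2.1 - z.2.2.2) :=
      primrec_lastBits.comp Primrec.fst (Primrec.nat_sub.comp (Primrec.nat_div.comp
        (Primrec.nat_mul.comp (primrec_pow.comp (Primrec.const 2) Primrec.fst)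
          (Primrec.fst.comp Primrec.snd)) (Primrec.fst.comp (Primrec.snd.comp Primrec.snd)))
        (Primrec.snd.comp (Primrec.snd.comp Primrec.snd)))
    have hz : Computable fun z : ((ℕ × List Bool) × ℕ) × ℕ => (nn z.1.1, a z.2, b z.2, ee z.1.1) :=
      (hnn.to_comp.comp (Computable.fst.comp Computable.fst)).pair
        ((ha.comp Computable.snd).pair ((hb.comp Computable.snd).pair
          (hee.to_comp.comp (Computable.fst.comp Computable.fst))))
    have h' := h.to_comp.comp hz
    exact Computable₂.mk (h'.of_eq fun _ => rfl)
  let f : ℕ × List Bool →. List Bool := fun y => (Nat.rfind fun k => Part.some (p y k)).bind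
    fun k => (Nat.rfind fun j => Part.some (q (y, k) j)).map (out (y, k))
  refine ⟨f, ?_, fun m n x hk hj => ?_⟩
  · exact Partrec.bind (Partrec.rfind hp.partrec₂)
      (Partrec.map (Partrec.rfind hq.partrec₂) hout)
  -- Neither search looks at `e`, so the correction can be chosen once `k` and `j` are known.
  · refine ⟨Nat.find hk, Nat.find (hj (Nat.find hk)), Nat.find_spec hk,
      Nat.find_spec (hj (Nat.find hk)), fun e => ?_⟩
    set y : ℕ × List Bool := (Nat.pair m (Nat.pair n e), x) with hy
    have hym : mm y = m := by simp [mm, hy]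
    have hyn : nn y = n := by simp [nn, hy]
    have hye : ee y = e := by simp [ee, hy]
    have hk' : Nat.find hk ∈ Nat.rfind fun k => Part.some (p y k) := by
      refine Nat.mem_rfind.2 ⟨?_, fun {i} hi => ?_⟩
      · simp only [p, hym, Part.mem_some_iff]
        exact (decide_eq_true (Nat.find_spec hk)).symm
      · simp only [p, hym, Part.mem_some_iff]
        exact (decide_eq_false (Nat.find_min hk hi)).symm
    have hj' : Nat.find (hj (Nat.find hk)) ∈
        Nat.rfind fun j => Part.some (q (y, Nat.find hk) j) := by
      refine Nat.mem_rfind.2 ⟨?_, fun {i} hi => ?_⟩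
      · simp only [q, hyn, Part.mem_some_iff]
        exact (decide_eq_true (Nat.find_spec (hj (Nat.find hk)))).symm
      · simp only [q, hyn, Part.mem_some_iff]
        exact (decide_eq_false (Nat.find_min (hj (Nat.find hk)) hi)).symm
    refine Part.mem_bind hk' ?_
    have h3 := Part.mem_map (out (y, Nat.find hk)) hj'
    simp only [out, hyn, hye] at h3 ⊢
    exact h3

/-! ### Real-number meaning of the integer tests -/

/-- The codes found by stage `k`. -/
def stage (B : ℕ → ℕ → Bool) (k : ℕ) : Finset ℕ := (Finset.range k).filter fun i => B k i = true

/-- The sum of `2 ^ (-length / t)` over the strings found by stage `k`. -/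
noncomputable def stageSum (B : ℕ → ℕ → Bool) (k : ℕ) (t : ℝ) : ℝ :=
  ∑ i ∈ stage B k, (2 : ℝ) ^ (-(codeLength i : ℝ) / t)

lemma sum_range_cond (B : ℕ → ℕ → Bool) (k : ℕ) (g : ℕ → ℕ) :
    (∑ i ∈ Finset.range k, bif B k i then g i else 0) = ∑ i ∈ stage B k, g i := by
  rw [stage, Finset.sum_filter]
  refine Finset.sum_congr rfl fun i _ => ?_
  cases B k i <;> simp

lemma cast_kraftSum {B : ℕ → ℕ → Bool} {k : ℕ} (h : ∀ i ∈ stage B k, codeLength i ≤ i) :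
    (kraftSum B k : ℝ) = 2 ^ k * ∑ i ∈ stage B k, (1 / 2 : ℝ) ^ codeLength i := by
  rw [kraftSum, sum_range_cond, Finset.mul_sum]
  push_cast
  refine Finset.sum_congr rfl fun i hi => ?_
  -- This makes the truncated subtraction `k - codeLength i` in `kraftSum` exact.
  have hik : codeLength i ≤ k := (h i hi).trans (Finset.mem_range.1 (Finset.mem_filter.1 hi).1).le
  rw [one_div, inv_pow, ← div_eq_mul_inv, eq_div_iff (by positivity), ← pow_add,
    Nat.sub_add_cancel hik]

/-- Taking `a`-th powers clears the rational exponent: `y ^ a * 2 ^ (l * b) = 2 ^ (N * a)` for the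
real number `y` under the floor, so comparing an integer with `y` is exact integer arithmetic. -/
lemma rootFloor_eq {N l a b : ℕ} (ha : 0 < a) (hb : 0 < b) :
    rootFloor N l a b = ⌊(2 : ℝ) ^ N * (2 : ℝ) ^ (-(l : ℝ) / ((a : ℝ) / b))⌋₊ := by
  set y : ℝ := (2 : ℝ) ^ N * (2 : ℝ) ^ (-(l : ℝ) / ((a : ℝ) / b)) with hy
  have hy0 : 0 ≤ y := by positivity
  have ha' : (0 : ℝ) < a := by exact_mod_cast ha
  have hya : y ^ a * 2 ^ (l * b) = 2 ^ (N * a) := by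
    rw [hy, mul_pow, ← pow_mul, mul_assoc]
    have : ((2 : ℝ) ^ (-(l : ℝ) / ((a : ℝ) / b))) ^ a = ((2 : ℝ) ^ (l * b))⁻¹ := by
      rw [← Real.rpow_natCast, ← Real.rpow_mul (by norm_num),
        show -(l : ℝ) / ((a : ℝ) / b) * a = -((l * b : ℕ) : ℝ) by push_cast; field_simp,
        Real.rpow_neg (by norm_num), Real.rpow_natCast]
    rw [this, inv_mul_cancel₀ (by positivity), mul_one]
  have hiff (x : ℕ) : x ^ a * 2 ^ (l * b) ≤ 2 ^ (N * a) ↔ x ≤ ⌊y⌋₊ := by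
    rw [Nat.le_floor_iff hy0, ← pow_le_pow_iff_left₀ (Nat.cast_nonneg x) hy0 ha.ne',
      ← mul_le_mul_iff_left₀ (show (0 : ℝ) < 2 ^ (l * b) by positivity), hya]
    exact_mod_cast Iff.rfl
  have hyN : ⌊y⌋₊ ≤ 2 ^ N := by
    refine Nat.floor_le_of_le ?_
    push_cast
    refine mul_le_of_le_one_right (by positivity) ?_
    refine Real.rpow_le_one_of_one_le_of_nonpos (by norm_num) ?_
    exact div_nonpos_of_nonpos_of_nonneg (by simp) (by positivity)
  unfold rootFloor
  refine le_antisymm ?_ (Nat.le_findGreatest hyN ((hiff _).2 le_rfl))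
  exact (hiff _).1 (Nat.findGreatest_spec (P := fun x => x ^ a * 2 ^ (l * b) ≤ 2 ^ (N * a))
    (Nat.zero_le _) ((hiff 0).2 (Nat.zero_le _)))

lemma powSum_le {B : ℕ → ℕ → Bool} (k N : ℕ) {a b : ℕ} (ha : 0 < a) (hb : 0 < b) :
    (powSum B k N a b : ℝ) / 2 ^ N ≤ stageSum B k ((a : ℝ) / b) := by
  rw [div_le_iff₀ (by positivity), powSum, sum_range_cond, stageSum, Finset.sum_mul]
  push_cast
  refine Finset.sum_le_sum fun i _ => ?_
  rw [rootFloor_eq ha hb, mul_comm]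
  exact Nat.floor_le (by positivity)

/-- Each floor loses less than `1` and there are at most `k ≤ 2 ^ k` terms, so `k` extra bits of
precision keep the total rounding error below `2 ^ (-n)`. -/
lemma stageSum_le {B : ℕ → ℕ → Bool} (k n : ℕ) {a b : ℕ} (ha : 0 < a) (hb : 0 < b) :
    stageSum B k ((a : ℝ) / b) ≤ (powSum B k (n + k) a b : ℝ) / 2 ^ (n + k) + 1 / 2 ^ n := by
  have hcard : ((stage B k).card : ℝ) ≤ 2 ^ k := by
    have h1 : (stage B k).card ≤ k := (Finset.card_filter_le _ _).trans (Finset.card_range k).le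
    exact_mod_cast h1.trans Nat.lt_two_pow_self.le
  have h : stageSum B k ((a : ℝ) / b) * 2 ^ (n + k) ≤ powSum B k (n + k) a b + 2 ^ k := by
    refine le_trans ?_ (add_le_add_right hcard _)
    rw [powSum, sum_range_cond, stageSum, Finset.sum_mul, ← nsmul_one (stage B k).card,
      ← Finset.sum_const]
    push_cast
    rw [← Finset.sum_add_distrib]
    refine Finset.sum_le_sum fun i _ => ?_
    rw [rootFloor_eq ha hb, mul_comm]
    exact (Nat.lt_floor_add_one _).le
  rw [← le_div_iff₀ (by positivity), add_div] at h
  refine h.trans_eq ?_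
  congr 1
  rw [pow_add]
  field_simp

lemma powSumLe_iff {B : ℕ → ℕ → Bool} {n k a b u v w : ℕ} (hw : 0 < w) :
    PowSumLe B n k a b u v w ↔ a ≤ b ∧
      (powSum B k (n + k) a b : ℝ) / 2 ^ (n + k) ≤ ((v : ℝ) - u) / w + 2 / 2 ^ n := by
  refine and_congr_right fun _ => ?_
  have hw' : (0 : ℝ) < w := by exact_mod_cast hw
  have h : ((v : ℝ) - u) / w + 2 / 2 ^ n =
      (v * 2 ^ (n + k) + 2 ^ (k + 1) * w - u * 2 ^ (n + k)) / w / 2 ^ (n + k) := by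
    rw [pow_add, pow_succ]
    field_simp
    ring
  rw [h, div_le_div_iff_of_pos_right (by positivity), le_div_iff₀ hw', le_sub_iff_add_le]
  exact_mod_cast Iff.rfl

/-! ### Analytic estimates and binary digits -/

/-- For `r ≥ 1`, the `r`-th powers of a summable family have tails at most the `r`-th power of the
tails of the family. -/
lemma summable_rpow_and_tsum_sub_sum_le {ι : Type*} {f : ι → ℝ} (hf : ∀ i, 0 ≤ f i)
    (hs : Summable f) {r δ : ℝ} (hr : 1 ≤ r) :
    (Summable fun i => f i ^ r) ∧ ∀ F : Finset ι, (∑' i, f i) - ∑ i ∈ F, f i ≤ δ →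
      (∑' i, f i ^ r) - ∑ i ∈ F, f i ^ r ≤ δ ^ r := by
  -- Write `g i ^ r = g i * g i ^ (r - 1)` and bound the second factor by means of the whole sum.
  have key {κ : Type _} {g : κ → ℝ} (hg : ∀ i, 0 ≤ g i) (hs : Summable g) {δ : ℝ}
      (hδ : ∑' i, g i ≤ δ) (i : κ) : g i ^ r ≤ g i * δ ^ (r - 1) := by
    have hi : g i ≤ δ := (hs.le_tsum i fun j _ => hg j).trans hδ
    rcases (hg i).eq_or_lt with h0 | h0
    · rw [← h0, Real.zero_rpow (by linarith), zero_mul]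
    · calc g i ^ r = g i * g i ^ (r - 1) := by
            rw [Real.rpow_sub_one h0.ne']; field_simp
        _ ≤ g i * δ ^ (r - 1) := by
            gcongr
  have hsr : Summable fun i => f i ^ r :=
    Summable.of_nonneg_of_le (fun i => Real.rpow_nonneg (hf i) r) (key hf hs le_rfl)
      (hs.mul_right _)
  refine ⟨hsr, fun F hF => ?_⟩
  rw [← hs.sum_add_tsum_compl (s := F), add_sub_cancel_left] at hF
  rw [← hsr.sum_add_tsum_compl (s := F), add_sub_cancel_left]
  have hs' : Summable fun i : ((F : Set ι)ᶜ : Set ι) => f i := hs.subtype _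
  have h0 : 0 ≤ ∑' i : ((F : Set ι)ᶜ : Set ι), f i := tsum_nonneg fun i => hf i
  calc ∑' i : ((F : Set ι)ᶜ : Set ι), f i ^ r
      ≤ ∑' i : ((F : Set ι)ᶜ : Set ι), f i * δ ^ (r - 1) :=
        (hsr.subtype _).tsum_le_tsum
          (key (g := fun i : ((F : Set ι)ᶜ : Set ι) => f i) (fun i => hf i) hs' hF) (hs'.mul_right _)
    _ = (∑' i : ((F : Set ι)ᶜ : Set ι), f i) * δ ^ (r - 1) := tsum_mul_right
    _ ≤ δ * δ ^ (r - 1) := by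
        have := h0.trans hF
        gcongr
    _ = δ ^ r := by
        rcases (h0.trans hF).eq_or_lt with h | h
        · rw [← h, Real.zero_rpow (show r ≠ 0 by linarith), zero_mul]
        · rw [Real.rpow_sub_one h.ne']; field_simp

/-- A lower bound for the growth of `t ↦ 2 ^ (-l / t)` below `1`. -/
lemma mul_sub_le_two_rpow_sub {l T t : ℝ} (hl : 0 ≤ l) (hT : 0 < T) (hTt : T ≤ t) (ht : t ≤ 1) :
    (2 : ℝ) ^ (-l / T) * (l * Real.log 2) * (t - T) ≤ (2 : ℝ) ^ (-l / t) - (2 : ℝ) ^ (-l / T) := by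
  have ht0 : 0 < t := hT.trans_le hTt
  have h2 : 0 < Real.log 2 := Real.log_pos (by norm_num)
  have h1 : (2 : ℝ) ^ (-l / t) =
      (2 : ℝ) ^ (-l / T) * Real.exp (l * Real.log 2 * ((t - T) / (t * T))) := by
    rw [Real.rpow_def_of_pos (by norm_num), Real.rpow_def_of_pos (by norm_num), ← Real.exp_add]
    congr 1
    field_simp
    ring
  -- `1 / T - 1 / t = (t - T) / (t * T)`, and `t * T ≤ 1`.
  have h3 : t - T ≤ (t - T) / (t * T) := by
    rw [le_div_iff₀ (by positivity)]
    have : t * T ≤ 1 := by nlinarith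
    nlinarith
  have h4 := Real.add_one_le_exp (l * Real.log 2 * ((t - T) / (t * T)))
  have h5 : l * Real.log 2 * (t - T) ≤ l * Real.log 2 * ((t - T) / (t * T)) := by gcongr
  have h6 : (0 : ℝ) < (2 : ℝ) ^ (-l / T) := by positivity
  rw [h1, mul_assoc]
  nlinarith

/-- Bit `i` of `T`, counted from `0`, is the parity of `⌊T * 2 ^ (i + 1)⌋`, which is the integer
quotient of `⌊2 ^ n * T⌋` by `2 ^ (n - 1 - i)`. -/
lemma lastBits_floor_eq_firstBits {T : ℝ} (hT0 : 0 ≤ T) (hT1 : T < 1) (n : ℕ) :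
    lastBits n ⌊2 ^ n * T⌋₊ = firstBits T n := by
  unfold lastBits firstBits
  refine List.ext_getElem (by simp) fun i h₁ h₂ => ?_
  have hi : i < n := by simpa using h₁
  simp only [List.getElem_map, List.getElem_range, List.getElem_ofFn, Int.fract_eq_self.2 ⟨hT0, hT1⟩]
  have h : ⌊(2 : ℝ) ^ n * T⌋₊ / 2 ^ (n - 1 - i) = ⌊T * (2 : ℝ) ^ (i + 1)⌋₊ := by
    have h1 := Nat.floor_div_natCast ((2 : ℝ) ^ n * T) (2 ^ (n - 1 - i))
    rw [← h1]
    congr 1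
    push_cast
    rw [div_eq_iff (by positivity), mul_assoc, ← pow_add, show i + 1 + (n - 1 - i) = n by omega,
      mul_comm]
  rw [h]
  congr 1
  simp only [Real.digits, eq_iff_iff]
  rw [Fin.ext_iff]
  simp

/-! ### `CS V T` as a sum of powers of Kraft weights -/

/-- The codes of the strings compressed by `V`. -/
def compressedCodes (V : List Bool →. List Bool) : Set ℕ :=
  {i | ∃ s : List Bool, Encodable.encode s = i ∧ H V s < (s.length : ℕ∞)}

/-- The weight `2 ^ (-length)` on the codes of the strings compressed by `V`. -/
noncomputable def weight (V : List Bool →. List Bool) : ℕ → ℝ :=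
  (compressedCodes V).indicator fun i => (1 / 2 : ℝ) ^ codeLength i

lemma weight_nonneg (V : List Bool →. List Bool) (i : ℕ) : 0 ≤ weight V i :=
  Set.indicator_nonneg (fun _ _ => by positivity) i

lemma weight_of_mem {V : List Bool →. List Bool} {i : ℕ} (h : i ∈ compressedCodes V) :
    weight V i = (1 / 2 : ℝ) ^ codeLength i := Set.indicator_of_mem h _

lemma weight_rpow_of_mem {V : List Bool →. List Bool} {i : ℕ} (h : i ∈ compressedCodes V) (T : ℝ) :
    weight V i ^ (1 / T) = (2 : ℝ) ^ (-(codeLength i : ℝ) / T) := by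
  rw [weight_of_mem h, one_div 2, inv_pow, ← Real.rpow_natCast, ← Real.rpow_neg (by norm_num),
    ← Real.rpow_mul (by norm_num), mul_one_div]

lemma sum_weight_le {V : List Bool →. List Bool} (hV : IsPrefixFreeMachine V) (F : Finset ℕ) :
    ∑ i ∈ F, weight V i ≤ 1 := by
  classical
  rw [← Finset.sum_filter_ne_zero]
  have hmem : ∀ i ∈ F.filter fun i => weight V i ≠ 0, i ∈ compressedCodes V := fun i hi =>
    Set.mem_of_indicator_ne_zero (Finset.mem_filter.1 hi).2
  set G := F.filter fun i => weight V i ≠ 0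
  have h : ∑ i ∈ G, weight V i = ∑ s ∈ G.preimage (Encodable.encode : List Bool → ℕ)
      Encodable.encode_injective.injOn, (1 / 2 : ℝ) ^ s.length := by
    rw [← Finset.sum_preimage (Encodable.encode : List Bool → ℕ) G
      Encodable.encode_injective.injOn (weight V)]
    · refine Finset.sum_congr rfl fun s hs => ?_
      rw [weight_of_mem (hmem _ (Finset.mem_preimage.1 hs)), codeLength_encode]
    · rintro i hi hi'
      obtain ⟨s, hs, -⟩ := hmem i hi
      exact absurd ⟨s, hs⟩ hi'
  rw [h]
  refine sum_two_pow_neg_length_le hV _ fun s hs => ?_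
  obtain ⟨t, ht, hlt⟩ := hmem _ (Finset.mem_preimage.1 hs)
  rwa [Encodable.encode_injective ht] at hlt

lemma summable_weight {V : List Bool →. List Bool} (hV : IsPrefixFreeMachine V) :
    Summable (weight V) :=
  summable_of_sum_le (weight_nonneg V) (sum_weight_le hV)

lemma tsum_weight_le {V : List Bool →. List Bool} (hV : IsPrefixFreeMachine V) :
    ∑' i, weight V i ≤ 1 :=
  (summable_weight hV).tsum_le_of_sum_le (sum_weight_le hV)

/-- The codes outside `compressedCodes V` contribute `0 ^ (1 / T) = 0`, as the exponent is not zero.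
-/
lemma CS_eq_tsum (V : List Bool →. List Bool) {T : ℝ} (hT : 0 < T) :
    CS V T = ∑' i, weight V i ^ (1 / T) := by
  have hinj : Function.Injective fun s : {s : List Bool // H V s < (s.length : ℕ∞)} =>
      Encodable.encode s.1 := fun s t h => Subtype.ext (Encodable.encode_injective h)
  rw [← hinj.tsum_eq]
  · refine tsum_congr fun s => ?_
    rw [weight_rpow_of_mem ⟨s.1, rfl, s.2⟩, codeLength_encode]
  · intro i hi
    have : i ∈ compressedCodes V := by
      by_contra h
      refine hi ?_
      change weight V i ^ (1 / T) = 0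
      rw [weight, Set.indicator_of_notMem h, Real.zero_rpow (by positivity)]
    obtain ⟨s, hs, hlt⟩ := this
    exact ⟨⟨s, hlt⟩, hs⟩

lemma codeLength_le_of_mem {V : List Bool →. List Bool} {i : ℕ} (h : i ∈ compressedCodes V) :
    codeLength i ≤ i := by
  obtain ⟨s, rfl, -⟩ := h
  rw [codeLength_encode]
  exact Encodable.length_le_encode s

/-! ### Comparison of finite stages with the full sums -/

section Stages

variable {V : List Bool →. List Bool} {B : ℕ → ℕ → Bool}

lemma kraftExceeds_iff (hB : ∀ k i, B k i = true → i ∈ compressedCodes V) {m W k : ℕ} :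
    KraftExceeds B m W k ↔ (W : ℝ) / 2 ^ m < ∑ i ∈ stage B k, weight V i := by
  have hS : ∀ i ∈ stage B k, i ∈ compressedCodes V := fun i hi =>
    hB k i (Finset.mem_filter.1 hi).2
  rw [Finset.sum_congr rfl fun i hi => weight_of_mem (hS i hi), div_lt_iff₀ (by positivity),
    ← mul_lt_mul_iff_left₀ (show (0 : ℝ) < 2 ^ k by positivity), KraftExceeds]
  have h := cast_kraftSum (B := B) (k := k) fun i hi => codeLength_le_of_mem (hS i hi)
  rw [mul_right_comm, mul_comm _ ((2 : ℝ) ^ m),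
    mul_comm (∑ i ∈ stage B k, (1 / 2 : ℝ) ^ codeLength i), ← h]
  exact_mod_cast Iff.rfl

/-- A strict lower bound of the sum is already exceeded by a finite partial sum, and its finitely
many compressed codes are all present at some stage. -/
lemma exists_kraftExceeds (hV : IsPrefixFreeMachine V)
    (hB : ∀ k i, B k i = true → i ∈ compressedCodes V)
    (hB' : ∀ i ∈ compressedCodes V, ∀ᶠ k in atTop, B k i = true) {m W : ℕ}
    (hW : (W : ℝ) / 2 ^ m < ∑' i, weight V i) : ∃ k, KraftExceeds B m W k := by
  classical
  obtain ⟨F, hF⟩ := ((summable_weight hV).hasSum.eventually (lt_mem_nhds hW)).exists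
  have h : ∀ᶠ k in atTop, ∀ i ∈ F.filter fun i => weight V i ≠ 0, i ∈ stage B k := by
    refine (Finset.eventually_all _).2 fun i hi => ?_
    filter_upwards [hB' i (Set.mem_of_indicator_ne_zero (Finset.mem_filter.1 hi).2),
      eventually_gt_atTop i] with k hk hik
    exact Finset.mem_filter.2 ⟨Finset.mem_range.2 hik, hk⟩
  obtain ⟨k, hk⟩ := h.exists
  refine ⟨k, (kraftExceeds_iff hB).2 (hF.trans_le ?_)⟩
  rw [← Finset.sum_filter_ne_zero]
  exact Finset.sum_le_sum_of_subset_of_nonneg hk fun i _ _ => weight_nonneg V i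

lemma stageSum_eq (hB : ∀ k i, B k i = true → i ∈ compressedCodes V) (k : ℕ) (T : ℝ) :
    stageSum B k T = ∑ i ∈ stage B k, weight V i ^ (1 / T) :=
  Finset.sum_congr rfl fun i hi => (weight_rpow_of_mem (hB k i (Finset.mem_filter.1 hi).2) T).symm

lemma stageSum_le_CS (hV : IsPrefixFreeMachine V)
    (hB : ∀ k i, B k i = true → i ∈ compressedCodes V) (k : ℕ) {T : ℝ} (hT0 : 0 < T) (hT1 : T ≤ 1) :
    stageSum B k T ≤ CS V T := by
  rw [stageSum_eq hB, CS_eq_tsum V hT0]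
  -- Only the summability is used; the value of `δ` is irrelevant.
  exact (summable_rpow_and_tsum_sub_sum_le (weight_nonneg V) (summable_weight hV) (δ := 0)
    ((one_le_div hT0).2 hT1)).1.sum_le_tsum _ fun i _ => Real.rpow_nonneg (weight_nonneg V i) _

/-- If the stage `k` has almost all of the weight, then its sum is close to `CS V T`. -/
lemma CS_sub_stageSum_le (hV : IsPrefixFreeMachine V)
    (hB : ∀ k i, B k i = true → i ∈ compressedCodes V) {k m n : ℕ} {T : ℝ} (hT0 : 0 < T)
    (hT1 : T ≤ 1) (hm : T * n ≤ m)
    (h : (∑' i, weight V i) - ∑ i ∈ stage B k, weight V i ≤ (1 / 2) ^ m) :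
    CS V T - stageSum B k T ≤ 1 / 2 ^ n := by
  rw [stageSum_eq hB, CS_eq_tsum V hT0]
  refine ((summable_rpow_and_tsum_sub_sum_le (weight_nonneg V) (summable_weight hV)
    ((one_le_div hT0).2 hT1)).2 _ h).trans ?_
  -- `(2 ^ (-m)) ^ (1 / T) = 2 ^ (-m / T)`, and `m / T ≥ n`.
  rw [← Real.rpow_natCast, ← Real.rpow_mul (by norm_num), mul_one_div, ← one_div_pow,
    ← Real.rpow_natCast]
  refine Real.rpow_le_rpow_of_exponent_ge (by norm_num) (by norm_num) ?_
  rw [le_div_iff₀ hT0, mul_comm]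
  exact hm

/-- A missing string of length at most `m` would by itself leave a tail of at least `2 ^ (-m)`. -/
lemma mem_stage_of_tsum_sub_lt (hV : IsPrefixFreeMachine V) {k m i : ℕ}
    (hi : i ∈ compressedCodes V) (hm : codeLength i ≤ m)
    (h : (∑' i, weight V i) - ∑ i ∈ stage B k, weight V i < (1 / 2) ^ m) : i ∈ stage B k := by
  classical
  by_contra hk
  have h1 := (summable_weight hV).sum_le_tsum (insert i (stage B k)) fun j _ => weight_nonneg V j
  rw [Finset.sum_insert hk, weight_of_mem hi] at h1
  have h2 : (1 / 2 : ℝ) ^ m ≤ (1 / 2) ^ codeLength i :=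
    pow_le_pow_of_le_one (by norm_num) (by norm_num) hm
  linarith

lemma tendsto_stageSum {k : ℕ} {t : ℕ → ℝ} {T : ℝ} (hT : 0 < T) (ht : Tendsto t atTop (𝓝 T)) :
    Tendsto (fun j => stageSum B k (t j)) atTop (𝓝 (stageSum B k T)) :=
  tendsto_finsetSum _ fun _ _ =>
    (Real.continuousAt_const_rpow (by norm_num)).tendsto.comp (tendsto_const_nhds.div ht hT.ne')

/-- Every term is nondecreasing in `t`, so the growth of one term bounds that of the sum from below.
This converts closeness of sums into closeness of `t` to `T`. -/
lemma stageSum_sub_ge {k i : ℕ} (hi : i ∈ stage B k) {T t : ℝ} (hT : 0 < T) (hTt : T ≤ t)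
    (ht : t ≤ 1) :
    (2 : ℝ) ^ (-(codeLength i : ℝ) / T) * (codeLength i * Real.log 2) * (t - T) ≤
      stageSum B k t - stageSum B k T := by
  refine (mul_sub_le_two_rpow_sub (Nat.cast_nonneg _) hT hTt ht).trans ?_
  rw [stageSum, stageSum, ← Finset.sum_sub_distrib]
  refine Finset.single_le_sum (f := fun i => (2 : ℝ) ^ (-(codeLength i : ℝ) / t) -
    (2 : ℝ) ^ (-(codeLength i : ℝ) / T)) (fun j _ => sub_nonneg.2 ?_) hi
  refine Real.rpow_le_rpow_of_exponent_le (by norm_num) ?_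
  rw [neg_div, neg_div, neg_le_neg_iff]
  gcongr

end Stages

/-! ### Recovering the bits of `T` from bits of `Ω` -/

/-- A partial recursive function computes the first `n` bits of `T` from `n`, a string of length
`T * n + O(1)` and a bounded number. -/
theorem exists_partrec_firstBits {V : List Bool →. List Bool} (hV : IsOptimal V) {T : ℝ}
    (hT0 : 0 < T) (hT1 : T < 1) (hCS : LeftComputable (CS V T)) (hT : RightComputable T) :
    ∃ f : ℕ × List Bool →. List Bool, Partrec f ∧ ∃ D : ℕ, ∀ n : ℕ, ∃ (m e : ℕ) (x : List Bool),
      x.length = m ∧ (m : ℝ) ≤ T * n + D ∧ e ≤ D ∧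
        firstBits T n ∈ f (Nat.pair m (Nat.pair n e), x) := by
  obtain ⟨B, hBp, hB, hB'⟩ := exists_stages hV.1.1
  have hB'' : ∀ i ∈ compressedCodes V, ∀ᶠ k in atTop, B k i = true := by
    rintro _ ⟨s, rfl, hs⟩
    exact hB' s hs
  obtain ⟨s₀, hs₀⟩ := hV.exists_compressed
  set i₀ := Encodable.encode s₀ with hi₀
  have hi₀S : i₀ ∈ compressedCodes V := ⟨s₀, rfl, hs₀⟩
  have hl₀ : codeLength i₀ = s₀.length := codeLength_encode s₀
  have hpos : 0 < s₀.length := by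
    rcases Nat.eq_zero_or_pos s₀.length with h | h
    · simp [h] at hs₀
    · exact h
  obtain ⟨t, ⟨ta, tb, tc, hta, htb, htc, ht⟩, hTt, htlim⟩ := hT
  obtain ⟨g, ⟨u, v, w, hu, hv, hw, hg⟩, hCg, hglim⟩ := hCS
  -- The truncated subtraction is exact because every `t j ≥ T` is positive.
  let num : ℕ → ℕ := fun j => ta j - tb j
  let den : ℕ → ℕ := fun j => tc j + 1
  let den' : ℕ → ℕ := fun j => w j + 1
  have hnumc : Computable num := Primrec.nat_sub.to_comp.comp hta htb
  have hdenc : Computable den := Computable.succ.comp htc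
  have hden'c : Computable den' := Computable.succ.comp hw
  have hden (j : ℕ) : 0 < den j := Nat.succ_pos _
  have hden' (j : ℕ) : 0 < den' j := Nat.succ_pos _
  have htpos (j : ℕ) : (0 : ℝ) < t j := hT0.trans_le (hTt j)
  have hnum (j : ℕ) : 0 < num j := by
    have h : (0 : ℚ) < t j := by exact_mod_cast htpos j
    rw [ht, div_pos_iff_of_pos_right (by positivity), sub_pos] at h
    exact Nat.sub_pos_of_lt (by exact_mod_cast h)
  have htj (j : ℕ) : (t j : ℝ) = (num j : ℝ) / den j := by
    have : tb j ≤ ta j := (Nat.lt_of_sub_pos (hnum j)).le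
    rw [ht]
    simp only [num, den]
    push_cast [this]
    rfl
  have hgj (j : ℕ) : ((v j : ℝ) - u j) / den' j = -(g j : ℝ) := by
    rw [hg]
    simp only [den']
    push_cast
    ring
  obtain ⟨f, hf, hfspec⟩ := exists_partrec_search hBp hnumc hdenc hu hv hden'c
  set κ : ℝ := (2 : ℝ) ^ (-(codeLength i₀ : ℝ) / T) * (codeLength i₀ * Real.log 2)
  have hκ0 : 0 < κ := by
    have h1 : (0 : ℝ) < codeLength i₀ := by rw [hl₀]; exact_mod_cast hpos
    have h2 : 0 < Real.log 2 := Real.log_pos (by norm_num)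
    positivity
  refine ⟨f, hf, s₀.length + 1 + (⌈4 / κ⌉₊ + 1), fun n => ?_⟩
  set Ω := ∑' i, weight V i
  have hΩ0 : 0 < Ω := (summable_weight hV.1).tsum_pos (weight_nonneg V) i₀
    (by rw [weight_of_mem hi₀S]; positivity)
  have hΩ1 : Ω ≤ 1 := tsum_weight_le hV.1
  -- The extra `s₀.length` bits force `s₀` into the stage that is found, whatever `n` is.
  set m := ⌈T * n⌉₊ + s₀.length with hm
  have hTn : 0 ≤ T * n := by positivity
  have hmn : T * n ≤ m := (Nat.le_ceil _).trans (by exact_mod_cast Nat.le_add_right _ _)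
  have hm_le : (m : ℝ) ≤ T * n + s₀.length + 1 := by
    have := (Nat.ceil_lt_add_one hTn).le
    push_cast [hm]
    linarith
  have hc0 : 0 < ⌈2 ^ m * Ω⌉₊ := Nat.ceil_pos.2 (by positivity)
  -- Ceiling minus one, not the floor: `W / 2 ^ m` must be strictly below `Ω` to be exceeded at a
  -- finite stage, and `W` fits in `m` bits even if `Ω = 1`.
  obtain ⟨W, hW⟩ : ∃ W, ⌈2 ^ m * Ω⌉₊ = W + 1 := ⟨_, (Nat.succ_pred_eq_of_pos hc0).symm⟩
  have hW1 : (W : ℝ) < 2 ^ m * Ω := Nat.lt_ceil.1 (by omega)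
  have hW2 : 2 ^ m * Ω ≤ W + 1 := by
    have := Nat.le_ceil (2 ^ m * Ω)
    rw [hW] at this
    exact_mod_cast this
  have hW3 : W < 2 ^ m := by
    have : (W : ℝ) < 2 ^ m := hW1.trans_le (mul_le_of_le_one_right (by positivity) hΩ1)
    exact_mod_cast this
  obtain ⟨x, hx, rfl⟩ := exists_bitsVal_eq m W hW3
  have hk : ∃ k, KraftExceeds B m (bitsVal x) k := by
    refine exists_kraftExceeds hV.1 hB hB'' ?_
    rw [div_lt_iff₀' (by positivity)]
    exact hW1
  have hj (k : ℕ) : ∃ j, PowSumLe B n k (num j) (den j) (u j) (v j) (den' j) := by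
    have h1 : Tendsto (fun j => stageSum B k (t j) + g j) atTop (𝓝 (stageSum B k T + -CS V T)) :=
      (tendsto_stageSum hT0 htlim).add hglim
    have h2 : stageSum B k T + -CS V T < 2 / 2 ^ n := by
      have h3 := stageSum_le_CS hV.1 hB k hT0 hT1.le
      have h4 : (0 : ℝ) < 2 / 2 ^ n := by positivity
      linarith
    obtain ⟨j, hj1, hj2⟩ :=
      ((h1.eventually (gt_mem_nhds h2)).and (htlim.eventually (gt_mem_nhds hT1))).exists
    refine ⟨j, (powSumLe_iff (hden' j)).2 ⟨?_, ?_⟩⟩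
    · rw [htj, div_lt_one (by exact_mod_cast hden j)] at hj2
      exact_mod_cast hj2.le
    · rw [hgj]
      have h5 := powSum_le (B := B) k (n + k) (hnum j) (hden j)
      rw [← htj] at h5
      linarith
  obtain ⟨k, j, hk, hj, hmem⟩ := hfspec m n x hk hj
  rw [kraftExceeds_iff hB, div_lt_iff₀' (by positivity)] at hk
  obtain ⟨hj1, hj2⟩ := (powSumLe_iff (hden' j)).1 hj
  have htail : Ω - ∑ i ∈ stage B k, weight V i < (1 / 2) ^ m := by
    rw [one_div_pow, lt_div_iff₀ (by positivity)]
    linarith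
  -- The clause `a ≤ b` of `PowSumLe` serves this purpose: the slope bound holds only up to `1`.
  have htj1 : (t j : ℝ) ≤ 1 := by
    rw [htj, div_le_one (by exact_mod_cast hden j)]
    exact_mod_cast hj1
  -- The `4` is `1` for the tail of `CS V T`, `1` for rounding and `2` for the slack in the test;
  -- `-g j ≤ CS V T` costs nothing.
  have hdiff : κ * (t j - T) ≤ 4 / 2 ^ n := by
    have h1 := CS_sub_stageSum_le hV.1 hB hT0 hT1.le hmn htail.le
    have h2 := stageSum_le (B := B) k n (hnum j) (hden j)
    have h3 := stageSum_sub_ge (mem_stage_of_tsum_sub_lt hV.1 hi₀S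
      (by rw [hl₀]; exact Nat.le_add_left _ _) htail) hT0 (hTt j) htj1
    have h4 := hCg j
    rw [← htj] at h2
    rw [hgj] at hj2
    have h5 : (4 : ℝ) / 2 ^ n = 1 / 2 ^ n + 1 / 2 ^ n + 2 / 2 ^ n := by ring
    linarith
  have hdiff' : 2 ^ n * (t j : ℝ) ≤ 2 ^ n * T + 4 / κ := by
    rw [← sub_le_iff_le_add', le_div_iff₀ hκ0]
    rw [le_div_iff₀ (by positivity)] at hdiff
    linarith
  have hfloor : 2 ^ n * num j / den j = ⌊2 ^ n * (t j : ℝ)⌋₊ := by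
    rw [htj, ← mul_div_assoc, ← Nat.floor_div_eq_div (K := ℝ)]
    push_cast
    rfl
  have hle : ⌊2 ^ n * T⌋₊ ≤ ⌊2 ^ n * (t j : ℝ)⌋₊ :=
    Nat.floor_le_floor (mul_le_mul_of_nonneg_left (hTt j) (by positivity))
  have hge : ⌊2 ^ n * (t j : ℝ)⌋₊ ≤ ⌊2 ^ n * T⌋₊ + (⌈4 / κ⌉₊ + 1) := by
    have h1 := Nat.floor_le (show (0 : ℝ) ≤ 2 ^ n * t j from
      mul_nonneg (by positivity) (htpos j).le)
    have h2 := Nat.lt_floor_add_one (2 ^ n * T)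
    have h3 := Nat.le_ceil (4 / κ)
    have h4 : ((⌊2 ^ n * (t j : ℝ)⌋₊ : ℕ) : ℝ) < ⌊2 ^ n * T⌋₊ + (⌈4 / κ⌉₊ + 1) := by linarith
    exact_mod_cast h4.le
  refine ⟨m, ⌊2 ^ n * (t j : ℝ)⌋₊ - ⌊2 ^ n * T⌋₊, x, hx, ?_, by omega, ?_⟩
  · push_cast
    have : (0 : ℝ) ≤ ⌈4 / κ⌉₊ := Nat.cast_nonneg _
    linarith
  · have h := hmem (⌊2 ^ n * (t j : ℝ)⌋₊ - ⌊2 ^ n * T⌋₊)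
    rwa [hfloor, Nat.sub_sub_self hle, lastBits_floor_eq_firstBits hT0.le hT1] at h

/-! ### The logarithmic overhead -/

lemma pair_pair_lt {m n e N : ℕ} (hm : m < N) (hn : n < N) (he : e < N) :
    Nat.pair m (Nat.pair n e) < N ^ 4 := by
  have h1 : Nat.pair n e < N ^ 2 := (Nat.pair_lt_max_add_one_sq n e).trans_le
    (Nat.pow_le_pow_left (by omega) 2)
  have h2 : N ≤ N ^ 2 := Nat.le_self_pow two_ne_zero N
  refine (Nat.pair_lt_max_add_one_sq _ _).trans_le ?_
  rw [show N ^ 4 = (N ^ 2) ^ 2 by ring]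
  exact Nat.pow_le_pow_left (by omega) 2

theorem exists_H_firstBits_le {U V : List Bool →. List Bool} (hU : IsOptimal U) (hV : IsOptimal V)
    {T : ℝ} (hT0 : 0 < T) (hT1 : T < 1) (hCS : LeftComputable (CS V T)) (hT : RightComputable T) :
    ∃ C : ℝ, ∀ n : ℕ, 2 ≤ n → ((H U (firstBits T n) : ℕ∞) : ℝ≥0∞) ≤
      ENNReal.ofReal (T * (n : ℝ) + C * Real.logb 2 (n : ℝ)) := by
  obtain ⟨f, hf, D, hD⟩ := exists_partrec_firstBits hV hT0 hT1 hCS hT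
  obtain ⟨d, hd⟩ := hU.exists_H_le hf
  -- The header costs `2 * 4 * (log N + 1)` with `N = n + D + 1 ≤ n * (D + 2)`; the additive
  -- constants are absorbed using `logb 2 n ≥ 1`.
  refine ⟨8 * (1 + Real.logb 2 (D + 2)) + 8 + D + d, fun n hn => ?_⟩
  obtain ⟨m, e, x, hx, hm, he, hmem⟩ := hD n
  have hn2 : (2 : ℝ) ≤ n := by exact_mod_cast hn
  set N := n + D + 1 with hN
  have hmN : m < N := by
    have : (m : ℝ) ≤ n + D := hm.trans (by nlinarith)
    have : m ≤ n + D := by exact_mod_cast this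
    omega
  have ha : Nat.pair m (Nat.pair n e) < 2 ^ (4 * (Nat.log 2 N + 1)) := by
    refine (pair_pair_lt hmN (by omega) (by omega)).trans ?_
    rw [mul_comm 4, pow_mul]
    exact Nat.pow_lt_pow_left (Nat.lt_pow_succ_log_self one_lt_two N) (by norm_num)
  have h := hd _ _ x _ ha (by simp [hx]) hmem
  have h' : ((H U (firstBits T n) : ℕ∞) : ℝ≥0∞) ≤
      ((2 * (4 * (Nat.log 2 N + 1)) + x.length + d : ℕ) : ℝ≥0∞) := by
    have := ENat.toENNReal_le.2 h
    simpa only [ENat.toENNReal_coe] using this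
  refine h'.trans ?_
  rw [← ENNReal.ofReal_natCast]
  refine ENNReal.ofReal_le_ofReal ?_
  have hlog1 : (1 : ℝ) ≤ Real.logb 2 n := by
    rw [Real.le_logb_iff_rpow_le (by norm_num) (by linarith)]
    simpa using hn2
  have hlogD : 0 ≤ Real.logb 2 ((D : ℝ) + 2) :=
    Real.logb_nonneg (by norm_num) (by linarith [(Nat.cast_nonneg D : (0 : ℝ) ≤ D)])
  have hlogN : (Nat.log 2 N : ℝ) ≤ Real.logb 2 n + Real.logb 2 (D + 2) := by
    refine (Real.natLog_le_logb N 2).trans ?_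
    rw [← Real.logb_mul (by positivity) (by positivity)]
    refine Real.logb_le_logb_of_le (by norm_num) (by positivity) ?_
    push_cast [hN]
    nlinarith [(Nat.cast_nonneg D : (0 : ℝ) ≤ D)]
  rw [hx]
  push_cast
  have h1 : Real.logb 2 ((D : ℝ) + 2) ≤ Real.logb 2 ((D : ℝ) + 2) * Real.logb 2 n :=
    le_mul_of_one_le_right hlogD hlog1
  have h2 : (D : ℝ) ≤ D * Real.logb 2 n := le_mul_of_one_le_right (Nat.cast_nonneg D) hlog1
  have h3 : (d : ℝ) ≤ d * Real.logb 2 n := le_mul_of_one_le_right (Nat.cast_nonneg d) hlog1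
  linarith

lemma compressible_of_H_le {U : List Bool →. List Bool} {T α C : ℝ}
    (h : ∀ n : ℕ, 2 ≤ n → ((H U (firstBits α n) : ℕ∞) : ℝ≥0∞) ≤
      ENNReal.ofReal (T * (n : ℝ) + C * Real.logb 2 (n : ℝ))) : Compressible U T α := by
  have hlim : Tendsto (fun n : ℕ => T + C * (Real.logb 2 n / n)) atTop (𝓝 T) := by
    have h1 : Tendsto (fun x : ℝ => Real.log x / x) atTop (𝓝 0) :=
      Real.isLittleO_log_id_atTop.tendsto_div_nhds_zero
    have h2 := ((h1.comp tendsto_natCast_atTop_atTop).div_const (Real.log 2)).const_mul C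
    have h3 := h2.const_add T
    simp only [zero_div, mul_zero, add_zero] at h3
    refine h3.congr fun n => ?_
    simp only [Function.comp_apply, Real.logb]
    ring
  have hlim' := (ENNReal.continuous_ofReal.tendsto T).comp hlim
  unfold Compressible
  rw [← hlim'.limsup_eq]
  refine limsup_le_limsup ?_
  filter_upwards [eventually_ge_atTop 2] with n hn
  have hn0 : (0 : ℝ) < n := by exact_mod_cast (by omega : 0 < n)
  refine (ENNReal.div_le_div_right (h n hn) _).trans ?_
  rw [← ENNReal.ofReal_natCast n, ← ENNReal.ofReal_div_of_pos hn0]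
  refine (congrArg ENNReal.ofReal ?_).le
  field_simp

end AIT

theorem mainTheorem3 (U V : List Bool →. List Bool) (hU : AIT.IsOptimal U) (hV : AIT.IsOptimal V)
    (T : ℝ) (hT0 : 0 < T) (hT1 : T < 1)
    (hCS : AIT.LeftComputable (AIT.CS V T)) (hT : AIT.RightComputable T) :
    AIT.Compressible U T T ∧
      ∃ C : ℝ, ∀ n : ℕ, 2 ≤ n →
        ((AIT.H U (AIT.firstBits T n) : ℕ∞) : ENNReal) ≤
          ENNReal.ofReal (T * (n : ℝ) + C * Real.logb 2 (n : ℝ)) := by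
  obtain ⟨C, hC⟩ := AIT.exists_H_firstBits_le hU hV hT0 hT1 hCS hT
  exact ⟨AIT.compressible_of_H_le hC, C, hC⟩
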